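/- Let $d\ge 3$, $K\ge 4$ and $\alpha$ be natural numbers. A $(d,K,\alpha)$ prefix covering design consists of $d$ finite sequences $s_1,\dots,s_d$ over $[K]=\{1,\dots,K\}$ such that: (Triplet condition) for any three distinct $a,b,c\in[K]$ there are $i,i',i''\in\{1,\dots,d\}$ (not necessarily distinct) and integers $\ell,\ell',\ell''\ge 0$ with $\ell+\ell'+\ell''\le\alpha$ such that each of $a,b,c$ occurs among the first $\ell$ entries of $s_i$, the first $\ell'$ entries of $s_{i'}$, or the first $\ell''$ entries of $s_{i''}$; (Singleton condition) for every $x\in[K]$ that occurs at more than one position in $s_1,\dots,s_d$, we have $\ell_{\min}(x)+\ell_{\max}(x)\le\alpha+1$, where $\ell_{\min}(x)$ and $\ell_{\max}(x)$ are the smallest and the largest $\ell\ge 1$ such that $s_i[\ell]=x$ for some $i$. Let $\gamma_d=\sup\{K/\alpha : \text{there is a } (d,K,\alpha)\text{ prefix covering design}\}$. Theorem. The supremum defining $\gamma_4$ is taken over a non-empty set of real numbers that is bounded above, and $\gamma_4<2$. That is, there is an $\varepsilon>0$ such that $K/\alpha\le 2-\varepsilon$ for every $(4,K,\alpha)$ prefix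 covering design. -/

import Mathlib

/-- `OccursAt s x i ℓ` : the element `x` is the `ℓ`-th entry (levels are counted from `1`)
of the sequence `s i`. -/
def OccursAt {d K : ℕ} (s : Fin d → List (Fin K)) (x : Fin K) (i : Fin d) (ℓ : ℕ) : Prop :=
  1 ≤ ℓ ∧ (s i)[ℓ - 1]? = some x

/-- The set of all levels at which `x` occurs in some sequence. -/
def levels {d K : ℕ} (s : Fin d → List (Fin K)) (x : Fin K) : Set ℕ :=
  {ℓ | ∃ i, OccursAt s x i ℓ}

/-- The smallest level at which `x` occurs (used only for elements that do occur). -/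
noncomputable def ellMin {d K : ℕ} (s : Fin d → List (Fin K)) (x : Fin K) : ℕ :=
  sInf (levels s x)

/-- The largest level at which `x` occurs (used only for elements that do occur;
the set of levels is finite, as there are finitely many finite sequences). -/
noncomputable def ellMax {d K : ℕ} (s : Fin d → List (Fin K)) (x : Fin K) : ℕ :=
  sSup (levels s x)

/-- `x` occurs more than once in the sequences: there are two different positions `(i, ℓ)`
(in the same or in different sequences) that hold `x`. -/
def OccursMoreThanOnce {d K : ℕ} (s : Fin d → List (Fin K)) (x : Fin K) : Prop :=
  {p : Fin d × ℕ | OccursAt s x p.1 p.2}.Nontrivial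

/-- The triplet condition: any three distinct elements are contained in (at most) three prefixes
of total length at most `α`. -/
def TripletCondition {d K : ℕ} (α : ℕ) (s : Fin d → List (Fin K)) : Prop :=
  ∀ a b c : Fin K, a ≠ b → a ≠ c → b ≠ c →
    ∃ (i i' i'' : Fin d) (ℓ ℓ' ℓ'' : ℕ),
      (∀ x ∈ ({a, b, c} : Set (Fin K)),
        x ∈ (s i).take ℓ ∨ x ∈ (s i').take ℓ' ∨ x ∈ (s i'').take ℓ'') ∧
      ℓ + ℓ' + ℓ'' ≤ α

/-- The singleton condition. -/
def SingletonCondition {d K : ℕ} (α : ℕ) (s : Fin d → List (Fin K)) : Prop :=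
  ∀ x : Fin K, OccursMoreThanOnce s x → ellMin s x + ellMax s x ≤ α + 1

/-- The sequences `s 0, …, s (d - 1)` form a `(d, K, α)` prefix covering design. -/
structure IsPrefixCoveringDesign (d K α : ℕ) (s : Fin d → List (Fin K)) : Prop where
  three_le : 3 ≤ d
  four_le : 4 ≤ K
  triplet : TripletCondition α s
  singleton : SingletonCondition α s

/-- The set of all qualities `K / α` of `(d, K, α)` prefix covering designs.
(A design with `α = 0` does not exist, by the triplet condition.) -/
def qualities (d : ℕ) : Set ℝ :=
  {q | ∃ (K α : ℕ) (s : Fin d → List (Fin K)),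
    IsPrefixCoveringDesign d K α s ∧ q = (K : ℝ) / (α : ℝ)}

/-- `γ_d`, the supremum of the qualities of prefix covering designs with `d` sequences. -/
noncomputable def gammaPCD (d : ℕ) : ℝ := sSup (qualities d)

/-! Let α = 2H, and call levels up to H shallow and the others deep. If K were close to 2α = 4H,
almost every shallow position would hold an element with no other shallow occurrence
(`card_not_isShallow_le`, `card_positions_le_card_isSoleShallow`). By the singleton condition, an
element whose sole shallow level is about H - x has deep levels at most about H + x.

Take five windows of levels around H, each 100 times wider than the last. For b, c, a in
successively wider windows with different homes, the prefix budget 2H forces b and c to share a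
sequence, or b to occur deep in the home of a (`InWindow.share`). There is room for only about one
deep occurrence per element, which is too few (`window_types_contradiction`). Blowing up gives the
windows integral widths and makes ε independent of α. -/

/-! ### Combinatorics of homes and deep occurrences -/

open Finset in
/-- Types of elements in five windows: `h a` is the home sequence of `a`, `D a` is the set of
sequences in which `a` has a deep occurrence. -/
theorem window_types_contradiction {V : Type*} [DecidableEq V] (A : ℕ → Finset V) (h : V → Fin 4)
    (D : V → Finset (Fin 4)) (w : ℕ → ℕ) (hw : ∀ k, 0 < w k)
    (hsize : ∀ k ≤ 4, ∀ j, 92 * w k ≤ #{a ∈ A k | h a = j})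
    (hcap : ∀ k ≤ 4, ∀ i, #{a ∈ A k | i ∈ D a} ≤ 100 * w k)
    (hT : ∀ k k' k'', k < k' → k' < k'' → k'' ≤ 4 → ∀ b ∈ A k, ∀ c ∈ A k', ∀ a ∈ A k'',
      h b ≠ h c → h b ≠ h a → h c ≠ h a →
      h a ∈ D b ∨ ∃ i, i ∈ insert (h b) (D b) ∧ i ∈ insert (h c) (D c)) : False := by
  have hsum : ∀ k ≤ 4, ∀ S ⊆ A k, ∀ Q : Finset (Fin 4),
      ∑ a ∈ S, #(D a ∩ Q) ≤ #Q * (100 * w k) := by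
    intro k hk S hS Q
    calc ∑ a ∈ S, #(D a ∩ Q) = ∑ a ∈ S, ∑ i ∈ Q, if i ∈ D a then 1 else 0 := by
          refine sum_congr rfl fun a _ => ?_
          rw [← card_filter, inter_comm, filter_mem_eq_inter]
      _ = ∑ i ∈ Q, ∑ a ∈ S, if i ∈ D a then 1 else 0 := sum_comm
      _ ≤ ∑ i ∈ Q, 100 * w k := by
          refine sum_le_sum fun i _ => ?_
          rw [← card_filter]
          exact (card_le_card (filter_subset_filter _ hS)).trans (hcap k hk i)
      _ = _ := by simp
  have hne : ∀ k ≤ 4, ∀ j, ∃ a ∈ A k, h a = j := by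
    intro k hk j
    have h1 := hsize k hk j
    have h2 := hw k
    obtain ⟨a, ha⟩ := card_pos.1 (show 0 < #{a ∈ A k | h a = j} by omega)
    exact ⟨a, mem_filter.1 ha⟩
  -- The two homes and `D b` leave one of the four sequences free; an element of window 4 with that
  -- home rules out the first alternative of `hT`.
  have hstar : ∀ k k', k < k' → k' < 4 → ∀ b ∈ A k, ∀ c ∈ A k', h b ≠ h c → #(D b) ≤ 1 →
      ∃ i, i ∈ insert (h b) (D b) ∧ i ∈ insert (h c) (D c) := by
    intro k k' hk hk' b hb c hc hbc hD
    have key : ∀ i j : Fin 4, i ≠ j → ∀ S : Finset (Fin 4), #S ≤ 1 →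
        ∃ l, i ≠ l ∧ j ≠ l ∧ l ∉ S := by decide
    obtain ⟨l, h1, h2, h3⟩ := key _ _ hbc _ hD
    obtain ⟨a, ha, rfl⟩ := hne 4 le_rfl l
    exact (hT k k' 4 hk hk' le_rfl b hb c hc a ha hbc h1 h2).resolve_left h3
  -- Averaging: at least 368 `w 0` elements compete for 400 `w 0` deep places.
  obtain ⟨b, hb, hDb⟩ : ∃ b ∈ A 0, #(D b) ≤ 1 := by
    by_contra! hcon
    have h1 := hsum 0 (by norm_num) (A 0) subset_rfl univ
    have h2 : #(A 0) * 2 ≤ ∑ a ∈ A 0, #(D a ∩ univ) := by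
      rw [← smul_eq_mul]
      refine card_nsmul_le_sum _ _ _ fun a ha => ?_
      simpa using Nat.succ_le_of_lt (hcon a ha)
    have h3 : #(A 0) = ∑ j : Fin 4, #{a ∈ A 0 | h a = j} :=
      card_eq_sum_card_fiberwise fun _ _ => mem_coe.2 (mem_univ _)
    have h4 : ∑ _j : Fin 4, 92 * w 0 ≤ #(A 0) :=
      h3 ▸ sum_le_sum fun j _ => hsize 0 (by norm_num) j
    simp only [sum_const, card_univ, Fintype.card_fin, smul_eq_mul] at h1 h4
    have := hw 0
    omega
  obtain ⟨r, q, q', hEb, hpq⟩ : ∃ r q q' : Fin 4, (∀ i ∈ insert (h b) (D b), i = h b ∨ i = r) ∧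
      [h b, r, q, q'].Nodup := by
    have key : ∀ j : Fin 4, ∀ S : Finset (Fin 4), #S ≤ 1 → ∃ r q q' : Fin 4,
        (∀ i ∈ insert j S, i = j ∨ i = r) ∧ [j, r, q, q'].Nodup := by decide
    exact key _ _ hDb
  set p := h b with hp
  simp only [List.nodup_cons, List.mem_cons, List.not_mem_nil, or_false, not_or, not_false_eq_true,
    List.nodup_nil, and_true] at hpq
  obtain ⟨⟨hpr, hpq, hpq'⟩, ⟨hrq, hrq'⟩, hqq'⟩ := hpq
  have hall : ∀ i : Fin 4, i = p ∨ i = r ∨ i = q ∨ i = q' := by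
    clear hEb hp
    clear_value p
    revert p r q q'
    decide
  have hQ : ∀ k, 0 < k → k < 4 → ∀ c ∈ A k, (h c = q ∨ h c = q') →
      (D c ∩ {p, r}).Nonempty := by
    intro k h0 hk c hc hcq
    have hbc : h b ≠ h c := by rcases hcq with h | h <;> rw [h] <;> assumption
    obtain ⟨i, hi, hi'⟩ := hstar 0 k h0 hk b hb c hc hbc hDb
    have hi2 := hEb i hi
    refine ⟨i, mem_inter.2 ⟨(mem_insert.1 hi').resolve_left ?_, by simpa using hi2⟩⟩
    rintro rfl
    rcases hcq with h | h <;> rcases hi2 with h' | h' <;> rw [h] at h' <;> simp_all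
  let B : ℕ → Fin 4 → Finset V := fun k j => {a ∈ A k | h a = j ∧ ¬ (D a ∩ {p, r}).Nonempty}
  have hBA : ∀ k j, B k j ⊆ A k := fun k j => filter_subset _ _
  have hBh : ∀ k j, ∀ a ∈ B k j, h a = j := fun k j a ha => (mem_filter.1 ha).2.1
  have hBD : ∀ k j, ∀ a ∈ B k j, ∀ i ∈ D a, i = q ∨ i = q' := by
    intro k j a ha i hi
    have h1 := (mem_filter.1 ha).2.2
    rcases hall i with h | h | h | h
    · exact absurd ⟨i, mem_inter.2 ⟨hi, by simp [h]⟩⟩ h1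
    · exact absurd ⟨i, mem_inter.2 ⟨hi, by simp [h]⟩⟩ h1
    · exact .inl h
    · exact .inr h
  -- By `hQ`, homes `q` and `q'` use 184 of the 200 units of deep room in `p` and `r`; 92 - 16 = 76.
  have hBsize : ∀ k, 0 < k → k < 4 → ∀ j, (j = p ∨ j = r) → 76 * w k ≤ #(B k j) := by
    intro k h0 hk j hj
    have hdisj : Disjoint ({a ∈ A k | h a = q} ∪ {a ∈ A k | h a = q'})
        {a ∈ A k | h a = j ∧ (D a ∩ {p, r}).Nonempty} := by
      rw [disjoint_left]
      intro a ha ha'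
      simp only [mem_union, mem_filter] at ha ha'
      rcases ha with ha | ha <;> rcases hj with hj | hj <;> simp_all
    have hdisj' : Disjoint {a ∈ A k | h a = q} {a ∈ A k | h a = q'} := by
      rw [disjoint_left]
      intro a ha ha'
      simp only [mem_filter] at ha ha'
      exact hqq' (ha.2.symm.trans ha'.2)
    have h1 := hsum k hk.le (({a ∈ A k | h a = q} ∪ {a ∈ A k | h a = q'}) ∪
        {a ∈ A k | h a = j ∧ (D a ∩ {p, r}).Nonempty})
      (union_subset (union_subset (filter_subset _ _) (filter_subset _ _)) (filter_subset _ _))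
      {p, r}
    have h2 := card_nsmul_le_sum
      (({a ∈ A k | h a = q} ∪ {a ∈ A k | h a = q'}) ∪
        {a ∈ A k | h a = j ∧ (D a ∩ {p, r}).Nonempty}) (fun a => #(D a ∩ {p, r})) 1 (by
      intro a ha
      simp only [mem_union, mem_filter] at ha
      refine card_pos.2 ?_
      rcases ha with (ha | ha) | ha
      · exact hQ k h0 hk a ha.1 (.inl ha.2)
      · exact hQ k h0 hk a ha.1 (.inr ha.2)
      · exact ha.2.2)
    rw [card_union_of_disjoint hdisj, card_union_of_disjoint hdisj', smul_eq_mul, mul_one] at h2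
    rw [card_pair hpr] at h1
    have h3 := hsize k hk.le q
    have h4 := hsize k hk.le q'
    have h5 := hsize k hk.le j
    have h6 : #{a ∈ A k | h a = j} =
        #{a ∈ A k | h a = j ∧ (D a ∩ {p, r}).Nonempty} + #(B k j) := by
      rw [← card_filter_add_card_filter_not (s := {a ∈ A k | h a = j})
        (fun a => (D a ∩ {p, r}).Nonempty), filter_filter, filter_filter]
    omega
  have hmeet : ∀ k k', k < k' → k' < 4 → ∀ j j', (j = p ∨ j = r) → (j' = p ∨ j' = r) → j ≠ j' →
      ∀ a ∈ B k j, ∀ c ∈ B k' j', #(D a) ≤ 1 → ∃ i ∈ D a, i ∈ D c := by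
    intro k k' hk hk' j j' hj hj' hjj a ha c hc hDa
    have ea := hBh _ _ _ ha
    have ec := hBh _ _ _ hc
    obtain ⟨i, hi, hi'⟩ := hstar k k' hk hk' a (hBA _ _ ha) c (hBA _ _ hc) (by rwa [ea, ec]) hDa
    rw [ea, mem_insert] at hi
    rw [ec, mem_insert] at hi'
    have hjq : ∀ j, (j = p ∨ j = r) → j ≠ q ∧ j ≠ q' := by
      rintro j (rfl | rfl) <;> exact ⟨by assumption, by assumption⟩
    have hja : j' ∉ D a := fun hx => by
      rcases hBD _ _ _ ha _ hx with hx | hx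
      exacts [(hjq _ hj').1 hx, (hjq _ hj').2 hx]
    have hjc : j ∉ D c := fun hx => by
      rcases hBD _ _ _ hc _ hx with hx | hx
      exacts [(hjq _ hj).1 hx, (hjq _ hj).2 hx]
    rcases hi with rfl | hi
    · rcases hi' with h | h
      exacts [absurd h hjj, absurd h hjc]
    · rcases hi' with rfl | h
      exacts [absurd hi hja, ⟨i, hi, h⟩]
  have hBne : ∀ k, 0 < k → k < 4 → ∀ j, (j = p ∨ j = r) → (B k j).Nonempty := by
    intro k h0 hk j hj
    have h1 := hBsize k h0 hk j hj
    have h2 := hw k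
    exact card_pos.1 (by omega)
  have hpos : ∀ k, 0 < k → k < 3 → ∀ j j', (j = p ∨ j = r) → (j' = p ∨ j' = r) → j ≠ j' →
      ∀ a ∈ B k j, 1 ≤ #(D a) := by
    intro k h0 hk j j' hj hj' hjj a ha
    by_contra hcon
    obtain ⟨c, hc⟩ := hBne 3 (by norm_num) (by norm_num) j' hj'
    obtain ⟨i, hi, -⟩ := hmeet k 3 hk (by norm_num) j j' hj hj' hjj a ha c hc (by omega)
    exact hcon (card_pos.2 ⟨i, hi⟩)
  -- Otherwise the deep occurrences number at least 2·76 + 76 = 228 units, against 200 units of room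
  -- in `q` and `q'`.
  have hsing : ∀ k, 0 < k → k < 3 → ∀ j j', (j = p ∨ j = r) → (j' = p ∨ j' = r) → j ≠ j' →
      ∃ a ∈ B k j, ∃ i, D a = {i} := by
    intro k h0 hk j j' hj hj' hjj
    by_contra! hcon
    have hdisj : Disjoint (B k j) (B k j') := by
      rw [disjoint_left]
      intro a ha ha'
      exact hjj ((hBh _ _ _ ha).symm.trans (hBh _ _ _ ha'))
    have hinter : ∀ j, ∀ a ∈ B k j, D a ∩ {q, q'} = D a := by
      intro j a ha
      refine inter_eq_left.2 fun i hi => ?_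
      simpa using hBD _ _ _ ha i hi
    have h1 := hsum k (by omega) (B k j ∪ B k j') (union_subset (hBA _ _) (hBA _ _)) {q, q'}
    rw [sum_union hdisj, card_pair hqq'] at h1
    have h2 : #(B k j) • 2 ≤ ∑ a ∈ B k j, #(D a ∩ {q, q'}) := by
      refine card_nsmul_le_sum _ _ _ fun a ha => ?_
      rw [hinter j a ha]
      have h3 := hpos k h0 hk j j' hj hj' hjj a ha
      have h4 : #(D a) ≠ 1 := fun h => by
        obtain ⟨i, hi⟩ := card_eq_one.1 h
        exact hcon a ha i hi
      omega
    have h3 : #(B k j') • 1 ≤ ∑ a ∈ B k j', #(D a ∩ {q, q'}) := by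
      refine card_nsmul_le_sum _ _ _ fun a ha => ?_
      rw [hinter j' a ha]
      exact hpos k h0 hk j' j hj' hj hjj.symm a ha
    rw [smul_eq_mul] at h2 h3
    have h4 := hBsize k h0 (by omega) j hj
    have h5 := hBsize k h0 (by omega) j' hj'
    have h6 := hw k
    omega
  -- The two singletons must coincide, and then force `i` on both classes of window 3: 152 units in
  -- a sequence with room for 100.
  obtain ⟨a, ha, i, hai⟩ := hsing 1 (by norm_num) (by norm_num) p r (.inl rfl) (.inr rfl) hpr
  obtain ⟨c, hc, i', hci⟩ :=
    hsing 2 (by norm_num) (by norm_num) r p (.inr rfl) (.inl rfl) (Ne.symm hpr)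
  have hac : ∀ k, 1 < k → k < 4 → ∀ x ∈ B k r, i ∈ D x := by
    intro k h1 hk x hx
    obtain ⟨l, hl, hl'⟩ := hmeet 1 k h1 hk p r (.inl rfl) (.inr rfl) hpr a ha x hx (by simp [hai])
    rw [hai, mem_singleton] at hl
    rwa [← hl]
  obtain rfl : i = i' := by
    have := hac 2 (by norm_num) (by norm_num) c hc
    rwa [hci, mem_singleton] at this
  have hcc : ∀ x ∈ B 3 p, i ∈ D x := by
    intro x hx
    obtain ⟨l, hl, hl'⟩ := hmeet 2 3 (by norm_num) (by norm_num) r p (.inr rfl) (.inl rfl)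
      (Ne.symm hpr) c hc x hx (by simp [hci])
    rw [hci, mem_singleton] at hl
    rwa [← hl]
  have hdisj : Disjoint (B 3 p) (B 3 r) := by
    rw [disjoint_left]
    intro a ha ha'
    exact hpr ((hBh _ _ _ ha).symm.trans (hBh _ _ _ ha'))
  have h1 : #(B 3 p ∪ B 3 r) ≤ #{a ∈ A 3 | i ∈ D a} := by
    refine card_le_card fun x hx => mem_filter.2 ?_
    rcases mem_union.1 hx with hx | hx
    exacts [⟨hBA _ _ hx, hcc x hx⟩, ⟨hBA _ _ hx, hac 3 (by norm_num) (by norm_num) x hx⟩]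
  rw [card_union_of_disjoint hdisj] at h1
  have h2 := hcap 3 (by norm_num) i
  have h3 := hBsize 3 (by norm_num) (by norm_num) p (.inl rfl)
  have h4 := hBsize 3 (by norm_num) (by norm_num) r (.inr rfl)
  have h5 := hw 3
  omega

/-! ### Position designs and their blow-ups -/

/-- A prefix covering design with four sequences as an occurrence relation on a type `V` of
elements. Every element has a home occurrence, whose level is at most `α + 1 - ℓ` for every other
occurrence of the element, at level `ℓ`. -/
structure PositionDesign (V : Type*) (α : ℕ) where
  /-- `Occ x i ℓ`: the element `x` is at level `ℓ` of sequence `i`. -/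
  Occ : V → Fin 4 → ℕ → Prop
  /-- The home occurrence. -/
  home : V → Fin 4 × ℕ
  occ_home : ∀ x, Occ x (home x).1 (home x).2
  one_le : ∀ x i ℓ, Occ x i ℓ → 1 ≤ ℓ
  inj : ∀ x y i ℓ, Occ x i ℓ → Occ y i ℓ → x = y
  add_home_le : ∀ x i ℓ, Occ x i ℓ → (i, ℓ) ≠ home x → ℓ + (home x).2 ≤ α + 1
  cover : ∀ a b c, ∃ (i : Fin 3 → Fin 4) (L : Fin 3 → ℕ), L 0 + L 1 + L 2 ≤ α ∧
    ∀ x, x = a ∨ x = b ∨ x = c → ∃ r, ∃ ℓ ≤ L r, Occ x (i r) ℓ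

/-- The home is an occurrence of least level. Only the sum inequality is recorded, as minimality
need not survive `blowUp`. -/
theorem exists_positionDesign {K α : ℕ} {s : Fin 4 → List (Fin K)}
    (hs : IsPrefixCoveringDesign 4 K α s) : Nonempty (PositionDesign (Fin K) α) := by
  have htake : ∀ x i L, x ∈ (s i).take L → ∃ ℓ ≤ L, OccursAt s x i ℓ := by
    intro x i L hx
    obtain ⟨n, hn, hx⟩ := List.mem_take_iff_getElem.1 hx
    refine ⟨n + 1, by omega, by omega, ?_⟩
    simp only [Nat.add_sub_cancel]
    rw [List.getElem?_eq_getElem (by omega), hx]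
  have hcover : ∀ a b c : Fin K, ∃ (i : Fin 3 → Fin 4) (L : Fin 3 → ℕ), L 0 + L 1 + L 2 ≤ α ∧
      ∀ x, x = a ∨ x = b ∨ x = c → ∃ r, ∃ ℓ ≤ L r, OccursAt s x (i r) ℓ := by
    intro a b c
    obtain ⟨S, hS, hcard⟩ := Finset.exists_superset_card_eq (s := ({a, b, c} : Finset (Fin K)))
      (n := 3) Finset.card_le_three (by have := hs.four_le; simp; omega)
    obtain ⟨a', b', c', hab, hac, hbc, rfl⟩ := Finset.card_eq_three.1 hcard
    obtain ⟨i, i', i'', ℓ, ℓ', ℓ'', h, hsum⟩ := hs.triplet a' b' c' hab hac hbc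
    refine ⟨![i, i', i''], ![ℓ, ℓ', ℓ''], by simpa using hsum, fun x hx => ?_⟩
    have hx' : x ∈ ({a', b', c'} : Set (Fin K)) := by
      have : x ∈ ({a', b', c'} : Finset (Fin K)) := hS (by simpa using hx)
      simpa using this
    rcases h x hx' with h | h | h
    · exact ⟨0, htake _ _ _ h⟩
    · exact ⟨1, htake _ _ _ h⟩
    · exact ⟨2, htake _ _ _ h⟩
  have hne : ∀ x, (levels s x).Nonempty := by
    intro x
    obtain ⟨i, L, -, h⟩ := hcover x x x
    obtain ⟨r, ℓ, -, h⟩ := h x (.inl rfl)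
    exact ⟨ℓ, i r, h⟩
  have hbdd : ∀ x, BddAbove (levels s x) := by
    intro x
    refine ⟨∑ i, (s i).length, ?_⟩
    rintro ℓ ⟨i, h1, h2⟩
    obtain ⟨h3, -⟩ := List.getElem?_eq_some_iff.1 h2
    have := Finset.single_le_sum (f := fun i => (s i).length) (fun _ _ => Nat.zero_le _)
      (Finset.mem_univ i)
    omega
  choose f hf using fun x => Nat.sInf_mem (hne x)
  exact ⟨{
    Occ := OccursAt s
    home := fun x => (f x, ellMin s x)
    occ_home := hf
    one_le := fun x i ℓ h => h.1
    inj := fun x y i ℓ hx hy => Option.some.inj (hx.2.symm.trans hy.2)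
    add_home_le := fun x i ℓ hx hne => by
      have h1 := hs.singleton x ⟨(i, ℓ), hx, (f x, ellMin s x), hf x, hne⟩
      have h2 : ℓ ≤ ellMax s x := le_csSup (hbdd x) ⟨i, hx⟩
      simp only
      omega
    cover := hcover }⟩

/-- Division with remainder in `[1, t]` is unique. -/
theorem eq_and_eq_of_mul_add_eq_mul_add {t ℓ ℓ' r r' : ℕ} (hr : 1 ≤ r) (hrt : r ≤ t)
    (hr' : 1 ≤ r') (hrt' : r' ≤ t) (h : ℓ * t + r = ℓ' * t + r') : ℓ = ℓ' ∧ r = r' := by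
  rcases lt_trichotomy ℓ ℓ' with hlt | rfl | hlt
  · have := Nat.mul_le_mul_right t (Nat.succ_le_of_lt hlt)
    rw [Nat.succ_mul] at this
    omega
  · omega
  · have := Nat.mul_le_mul_right t (Nat.succ_le_of_lt hlt)
    rw [Nat.succ_mul] at this
    omega

open Classical in
/-- Replace each element by `t` consecutive copies, in reversed order outside the home
occurrence. -/
noncomputable def PositionDesign.blowUp {V : Type*} {α : ℕ} (P : PositionDesign V α) (t : ℕ) :
    PositionDesign (V × Fin t) (α * t) where
  Occ x i L := ∃ ℓ, P.Occ x.1 i (ℓ + 1) ∧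
    L = ℓ * t + if (i, ℓ + 1) = P.home x.1 then x.2.1 + 1 else t - x.2.1
  home x := ((P.home x.1).1, ((P.home x.1).2 - 1) * t + (x.2.1 + 1))
  occ_home x := by
    have h := P.one_le _ _ _ (P.occ_home x.1)
    refine ⟨(P.home x.1).2 - 1, ?_, ?_⟩
    · rw [Nat.sub_add_cancel h]; exact P.occ_home x.1
    · rw [Nat.sub_add_cancel h, if_pos rfl]
  one_le := by
    rintro x i L ⟨ℓ, -, rfl⟩
    have := x.2.2
    split_ifs <;> omega
  inj := by
    rintro ⟨x, r⟩ ⟨y, r'⟩ i L ⟨ℓ, hx, rfl⟩ ⟨ℓ', hy, h⟩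
    simp only at hx hy h
    have h1 := r.2
    have h2 := r'.2
    obtain ⟨rfl, h3⟩ := eq_and_eq_of_mul_add_eq_mul_add (by split_ifs <;> omega)
      (by split_ifs <;> omega) (by split_ifs <;> omega) (by split_ifs <;> omega) h
    obtain rfl := P.inj _ _ _ _ hx hy
    congr 1
    ext
    split_ifs at h3 <;> omega
  add_home_le := by
    rintro ⟨x, r⟩ i L ⟨ℓ, hx, rfl⟩ hne
    simp only at hx hne ⊢
    have h1 := P.one_le _ _ _ (P.occ_home x)
    have h2 : (i, ℓ + 1) ≠ P.home x := by
      intro h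
      rw [if_pos h] at hne
      apply hne
      rw [← h]
      simp
    have h3 := P.add_home_le x i _ hx h2
    rw [if_neg h2]
    -- Because of the reversal, the offsets `r + 1` and `t - r` of each copy add up to `t + 1`.
    have h4 : (ℓ + ((P.home x).2 - 1) + 1) * t ≤ α * t := Nat.mul_le_mul_right t (by omega)
    rw [Nat.add_mul, Nat.add_mul] at h4
    have := r.2
    omega
  cover := by
    rintro ⟨a, r⟩ ⟨b, r'⟩ ⟨c, r''⟩
    obtain ⟨i, L, hL, h⟩ := P.cover a b c
    refine ⟨i, fun j => L j * t, ?_, ?_⟩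
    · simp only [← Nat.add_mul]
      exact Nat.mul_le_mul_right t hL
    · rintro ⟨x, rx⟩ hx
      obtain ⟨j, ℓ, hℓ, ho⟩ := h x (by
        rcases hx with hx | hx | hx <;> cases hx <;> simp)
      have h1 := P.one_le _ _ _ ho
      obtain ⟨ℓ, rfl⟩ : ∃ n, ℓ = n + 1 := ⟨ℓ - 1, by omega⟩
      refine ⟨j, _, ?_, ℓ, ho, rfl⟩
      have h2 : (ℓ + 1) * t ≤ L j * t := Nat.mul_le_mul_right t hℓ
      rw [Nat.succ_mul] at h2
      have := rx.2
      simp only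
      split_ifs <;> omega

theorem Fin.add_le_sum_three_of_ne (L : Fin 3 → ℕ) {r r' : Fin 3} (h : r ≠ r') :
    L r + L r' ≤ L 0 + L 1 + L 2 := by
  fin_cases r <;> fin_cases r' <;> simp at h ⊢ <;> omega

theorem Fin.sum_three_of_ne (L : Fin 3 → ℕ) {r r' r'' : Fin 3} (h : r ≠ r') (h' : r ≠ r'')
    (h'' : r' ≠ r'') : L r + L r' + L r'' = L 0 + L 1 + L 2 := by
  fin_cases r <;> fin_cases r' <;> simp at h <;> fin_cases r'' <;> simp at h' h'' ⊢ <;> omega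

namespace PositionDesign

open Finset

variable {V : Type*}

theorem card_le_card_positions {α : ℕ} (P : PositionDesign V α) (S : Finset V)
    (J : Finset (Fin 4 × ℕ)) (h : ∀ x ∈ S, ∃ p ∈ J, P.Occ x p.1 p.2) : #S ≤ #J := by
  choose! f hf hocc using h
  refine card_le_card_of_injOn f hf fun x hx y hy hxy => ?_
  have h1 := hocc x hx
  rw [hxy] at h1
  exact P.inj _ _ _ _ h1 (hocc y hy)

theorem card_le_card_levels {α : ℕ} (P : PositionDesign V α) (S : Finset V) (i : Fin 4)
    (I : Finset ℕ) (h : ∀ x ∈ S, ∃ ℓ ∈ I, P.Occ x i ℓ) : #S ≤ #I := by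
  have h1 := P.card_le_card_positions S ({i} ×ˢ I) fun x hx => by
    obtain ⟨ℓ, hℓ, ho⟩ := h x hx
    exact ⟨(i, ℓ), by simpa using hℓ, ho⟩
  simpa using h1

/-! ### Shallow elements and sole shallow occurrences -/

variable {H : ℕ}

/-- Some occurrence of `x` is in the first half of its sequence. -/
def IsShallow (P : PositionDesign V (2 * H)) (x : V) : Prop := ∃ i ℓ, ℓ ≤ H ∧ P.Occ x i ℓ

/-- `p` is the only occurrence of `x` in the first half of the sequences. -/
def IsSoleShallow (P : PositionDesign V (2 * H)) (x : V) (p : Fin 4 × ℕ) : Prop :=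
  P.Occ x p.1 p.2 ∧ p.2 ≤ H ∧ ∀ i ℓ, ℓ ≤ H → P.Occ x i ℓ → (i, ℓ) = p

/-- The home serves, unless the deep occurrence is itself the home; then any shallow occurrence
does. -/
theorem exists_add_le_of_isShallow (P : PositionDesign V (2 * H)) {x : V} (hx : P.IsShallow x)
    {i : Fin 4} {ℓ : ℕ} (ho : P.Occ x i ℓ) (hℓ : H < ℓ) :
    ∃ i' ℓ', ℓ' ≤ H ∧ P.Occ x i' ℓ' ∧ ℓ + ℓ' ≤ 2 * H + 1 := by
  by_cases h : (i, ℓ) = P.home x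
  · obtain ⟨i', ℓ', hℓ', ho'⟩ := hx
    have hne : (i', ℓ') ≠ P.home x := by
      rw [← h]
      intro h
      have := congrArg Prod.snd h
      simp only at this
      omega
    have h1 := P.add_home_le x i' ℓ' ho' hne
    rw [← h] at h1
    simp only at h1
    exact ⟨i', ℓ', hℓ', ho', by omega⟩
  · have h1 := P.add_home_le x i ℓ ho h
    exact ⟨_, _, by omega, P.occ_home x, h1⟩

theorem eq_home_of_not_isShallow (P : PositionDesign V (2 * H)) {x : V} (hx : ¬ P.IsShallow x)
    {i : Fin 4} {ℓ : ℕ} (ho : P.Occ x i ℓ) : (i, ℓ) = P.home x := by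
  by_contra h
  have h1 := P.add_home_le x i ℓ ho h
  have h2 : ∀ i ℓ, P.Occ x i ℓ → H < ℓ := fun i ℓ ho => by
    by_contra hcon
    exact hx ⟨i, ℓ, by omega, ho⟩
  have h3 := h2 _ _ ho
  have h4 := h2 _ _ (P.occ_home x)
  omega

-- An element that is not shallow occurs only at its home. Let `u` be the deepest such element, at
-- level H + D. Covering `u` and `b` puts `b` in the sequence of `u` or at a level up to H - D. So
-- there are N ≤ D non-shallow elements, and at most 4(H - D) + 2D others. Hence 2D ≤ N + e, which
-- gives N ≤ D ≤ e.
open Classical in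
theorem card_not_isShallow_le [Fintype V] (P : PositionDesign V (2 * H)) {e : ℕ}
    (he : 4 * H ≤ Fintype.card V + e) : #{x : V | ¬ P.IsShallow x} ≤ e := by
  rcases (univ.filter fun x => ¬ P.IsShallow x).eq_empty_or_nonempty with h0 | h0
  · simp [h0]
  obtain ⟨u, hu, hmax⟩ := exists_max_image _ (fun x => (P.home x).2) h0
  simp only [mem_filter, mem_univ, true_and] at hu hmax
  have hdeep : ∀ x, ¬ P.IsShallow x → H < (P.home x).2 := fun x hx => by
    by_contra hcon
    exact hx ⟨_, _, by omega, P.occ_home x⟩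
  obtain ⟨D, hD⟩ : ∃ D, (P.home u).2 = H + D := ⟨(P.home u).2 - H, by have := hdeep u hu; omega⟩
  have hcov : ∀ b, ∃ i, (∃ ℓ, P.Occ u i ℓ) ∧ ∃ L ℓ, ℓ ≤ L ∧
      (P.Occ b i ℓ ∨ ∃ i', P.Occ b i' ℓ ∧ L + (H + D) ≤ 2 * H) := by
    intro b
    obtain ⟨i, L, hL, h⟩ := P.cover u b b
    obtain ⟨r, ℓ, hℓ, ho⟩ := h u (.inl rfl)
    obtain ⟨r', ℓ', hℓ', ho'⟩ := h b (.inr (.inl rfl))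
    refine ⟨i r, ⟨ℓ, ho⟩, L r', ℓ', hℓ', ?_⟩
    by_cases hr : r = r'
    · exact .inl (hr ▸ ho')
    · have h1 := Fin.add_le_sum_three_of_ne L hr
      have h2 := congrArg Prod.snd (P.eq_home_of_not_isShallow hu ho)
      simp only at h2
      exact .inr ⟨_, ho', by omega⟩
  have hcov' : ∀ b, (∃ ℓ, P.Occ b (P.home u).1 ℓ) ∨ ∃ i ℓ, ℓ + D ≤ H ∧ P.Occ b i ℓ := by
    intro b
    obtain ⟨i, ⟨ℓ, ho⟩, L, ℓ', hℓ', h | ⟨i', h, hL⟩⟩ := hcov b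
    · rw [← P.eq_home_of_not_isShallow hu ho]
      exact .inl ⟨_, h⟩
    · exact .inr ⟨i', ℓ', by omega, h⟩
  have hDH : D ≤ H := by
    obtain ⟨i, L, hL, h⟩ := P.cover u u u
    obtain ⟨r, ℓ, hℓ, ho⟩ := h u (.inl rfl)
    have h2 := congrArg Prod.snd (P.eq_home_of_not_isShallow hu ho)
    simp only at h2
    have h3 : L r ≤ L 0 + L 1 + L 2 := by fin_cases r <;> simp <;> omega
    omega
  have hN : #{x : V | ¬ P.IsShallow x} ≤ D := by
    have h1 := P.card_le_card_levels {x : V | ¬ P.IsShallow x} (P.home u).1 (Ioc H (H + D)) (by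
      intro x hx
      simp only [mem_filter, mem_univ, true_and] at hx
      obtain ⟨ℓ, ho⟩ | ⟨i, ℓ, hℓ, ho⟩ := hcov' x
      · have h2 := congrArg Prod.snd (P.eq_home_of_not_isShallow hx ho)
        simp only at h2
        have h3 := hdeep x hx
        have h4 := hmax x hx
        exact ⟨ℓ, by simp; omega, ho⟩
      · exact absurd ⟨i, ℓ, by omega, ho⟩ hx)
    simpa using h1
  have hlow : #{x : V | ∃ i ℓ, ℓ + D ≤ H ∧ P.Occ x i ℓ} ≤ 4 * (H - D) := by
    have h1 := P.card_le_card_positions {x : V | ∃ i ℓ, ℓ + D ≤ H ∧ P.Occ x i ℓ}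
      (univ ×ˢ Ioc 0 (H - D)) (by
        intro x hx
        simp only [mem_filter, mem_univ, true_and] at hx
        obtain ⟨i, ℓ, hℓ, ho⟩ := hx
        have := P.one_le _ _ _ ho
        exact ⟨(i, ℓ), by simp; omega, ho⟩)
    simpa using h1
  have hhigh : #{x : V | P.IsShallow x ∧ ¬ ∃ i ℓ, ℓ + D ≤ H ∧ P.Occ x i ℓ} ≤ 2 * D := by
    have h1 := P.card_le_card_levels {x : V | P.IsShallow x ∧ ¬ ∃ i ℓ, ℓ + D ≤ H ∧ P.Occ x i ℓ}
      (P.home u).1 (Ioc (H - D) (H + D)) (by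
        intro x hx
        simp only [mem_filter, mem_univ, true_and] at hx
        obtain ⟨ℓ, ho⟩ := (hcov' x).resolve_right hx.2
        have h2 : ∀ i ℓ, P.Occ x i ℓ → H < ℓ + D := fun i ℓ ho => by
          by_contra hcon
          exact hx.2 ⟨i, ℓ, by omega, ho⟩
        have h3 := h2 _ _ ho
        refine ⟨ℓ, ?_, ho⟩
        by_cases hℓ : ℓ ≤ H
        · simp; omega
        · obtain ⟨i', ℓ', -, ho', h4⟩ := P.exists_add_le_of_isShallow hx.1 ho (by omega)
          have h5 := h2 _ _ ho'
          simp; omega)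
    rw [Nat.card_Ioc] at h1
    omega
  have hV : Fintype.card V ≤ #{x : V | ¬ P.IsShallow x} +
      #{x : V | ∃ i ℓ, ℓ + D ≤ H ∧ P.Occ x i ℓ} +
      #{x : V | P.IsShallow x ∧ ¬ ∃ i ℓ, ℓ + D ≤ H ∧ P.Occ x i ℓ} := by
    refine le_trans (card_le_card fun x _ => ?_)
      ((card_union_le _ _).trans (Nat.add_le_add_right (card_union_le _ _) _))
    simp only [mem_union, mem_filter, mem_univ, true_and]
    by_cases h1 : P.IsShallow x <;> by_cases h2 : ∃ i ℓ, ℓ + D ≤ H ∧ P.Occ x i ℓ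
    exacts [.inl (.inr h2), .inr ⟨h1, h2⟩, .inl (.inl h1), .inl (.inl h1)]
  omega

-- Choose one shallow position per shallow element. At most `e` positions remain unchosen, and every
-- further shallow occurrence uses one of them, so at most `e` elements have one.
open Classical in
theorem card_positions_le_card_isSoleShallow [Fintype V] (P : PositionDesign V (2 * H)) {e : ℕ}
    (he : 4 * H ≤ #{x : V | P.IsShallow x} + e) (J : Finset (Fin 4 × ℕ))
    (hJ : J ⊆ univ ×ˢ Ioc 0 H) : #J ≤ #{x : V | ∃ p ∈ J, P.IsSoleShallow x p} + 2 * e := by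
  set box : Finset (Fin 4 × ℕ) := univ ×ˢ Ioc 0 H with hbox
  have hmem : ∀ x p, P.Occ x p.1 p.2 → p.2 ≤ H → p ∈ box := by
    intro x p ho hp
    have := P.one_le _ _ _ ho
    simp only [hbox, mem_product, mem_univ, mem_Ioc, true_and]
    omega
  have hex : ∀ x, P.IsShallow x → ∃ p : Fin 4 × ℕ, P.Occ x p.1 p.2 ∧ p.2 ≤ H :=
    fun x ⟨i, ℓ, h, ho⟩ => ⟨(i, ℓ), ho, h⟩
  choose! g hgo hgH using hex
  set S : Finset V := {x : V | P.IsShallow x} with hS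
  have hSmem : ∀ x, x ∈ S ↔ P.IsShallow x := by simp [hS]
  have himage : #(S.image g) = #S := by
    refine card_image_of_injOn fun x hx y hy hxy => ?_
    have h1 := hgo x ((hSmem x).1 hx)
    rw [hxy] at h1
    exact P.inj _ _ _ _ h1 (hgo y ((hSmem y).1 hy))
  have hsub : S.image g ⊆ box := by
    intro p hp
    obtain ⟨x, hx, rfl⟩ := mem_image.1 hp
    rw [hSmem] at hx
    exact hmem x _ (hgo x hx) (hgH x hx)
  have hfree : #(box \ S.image g) ≤ e := by
    rw [card_sdiff_of_subset hsub, himage]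
    have : #box = 4 * H := by simp [hbox]
    omega
  set B : Finset V := {x ∈ S | ∃ p ∈ box, P.Occ x p.1 p.2 ∧ p ≠ g x} with hB
  have hBcard : #B ≤ e := by
    refine (P.card_le_card_positions B _ fun x hx => ?_).trans hfree
    obtain ⟨hx, p, hp, ho, hne⟩ := mem_filter.1 hx
    refine ⟨p, mem_sdiff.2 ⟨hp, fun hp' => ?_⟩, ho⟩
    obtain ⟨y, hy, rfl⟩ := mem_image.1 hp'
    exact hne (congrArg g (P.inj _ _ _ _ ho (hgo y ((hSmem y).1 hy)))).symm
  have hcover : J ⊆ (box \ S.image g) ∪ B.image g ∪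
      ({x : V | ∃ p ∈ J, P.IsSoleShallow x p} : Finset V).image g := by
    intro p hp
    by_cases h1 : p ∈ S.image g
    · obtain ⟨x, hx, rfl⟩ := mem_image.1 h1
      by_cases h2 : x ∈ B
      · exact mem_union_left _ (mem_union_right _ (mem_image_of_mem _ h2))
      · refine mem_union_right _ (mem_image_of_mem _ ?_)
        simp only [mem_filter, mem_univ, true_and]
        have hx' := (hSmem x).1 hx
        refine ⟨g x, hp, hgo x hx', hgH x hx', fun i ℓ hℓ ho => ?_⟩
        by_contra hne
        exact h2 (mem_filter.2 ⟨hx, (i, ℓ), hmem x _ ho hℓ, ho, hne⟩)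
    · exact mem_union_left _ (mem_union_left _ (mem_sdiff.2 ⟨hJ hp, h1⟩))
  have h1 := (card_le_card hcover).trans
    ((card_union_le _ _).trans (Nat.add_le_add_right (card_union_le _ _) _))
  have h2 := card_image_le (s := B) (f := g)
  have h3 := card_image_le (s := ({x : V | ∃ p ∈ J, P.IsSoleShallow x p} : Finset V)) (f := g)
  omega

theorem IsSoleShallow.add_le {P : PositionDesign V (2 * H)} {x : V} {p : Fin 4 × ℕ}
    (hx : P.IsSoleShallow x p) {i : Fin 4} {ℓ : ℕ} (ho : P.Occ x i ℓ) (hℓ : H < ℓ) :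
    ℓ + p.2 ≤ 2 * H + 1 := by
  obtain ⟨i', ℓ', h1, h2, h3⟩ :=
    P.exists_add_le_of_isShallow ⟨_, _, hx.2.1, hx.1⟩ ho hℓ
  rw [← hx.2.2 _ _ h1 h2]
  exact h3

/-! ### Windows around the middle level -/

/-- `x` has a sole shallow occurrence, at a level in `(H - w', H - w]`, and its other occurrences
are all at levels larger than `H + w`. -/
def InWindow (P : PositionDesign V (2 * H)) (w w' : ℕ) (x : V) (p : Fin 4 × ℕ) : Prop :=
  P.IsSoleShallow x p ∧ H < p.2 + w' ∧ p.2 + w ≤ H ∧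
    ∀ i ℓ, P.Occ x i ℓ → H < ℓ → H + w < ℓ

theorem InWindow.cases {P : PositionDesign V (2 * H)} {w w' : ℕ} {x : V} {p : Fin 4 × ℕ}
    (hx : P.InWindow w w' x p) {i : Fin 4} {ℓ : ℕ} (ho : P.Occ x i ℓ) :
    H < ℓ + w' ∧ (i = p.1 ∨ ∃ ℓ, H < ℓ ∧ P.Occ x i ℓ) ∧ (ℓ ≤ H + w → i = p.1) := by
  by_cases hℓ : ℓ ≤ H
  · have h1 := hx.1.2.2 _ _ hℓ ho
    have h2 := hx.2.1
    subst h1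
    exact ⟨h2, .inl rfl, fun _ => rfl⟩
  · have h1 := hx.2.2.2 _ _ ho (by omega)
    exact ⟨by omega, .inr ⟨ℓ, by omega, ho⟩, fun h => by omega⟩

/-- Three separate prefixes would be longer than 2H in total. If one prefix serves two of the
elements, the prefix of the third is nearly H long, which bounds the shared one. With `b` alone, it
is too short for deep occurrences of `a` and `c`, whose homes differ; with `c` alone, it is too
short for a deep occurrence of `a`, so it lies in the home of `a`. -/
theorem InWindow.share {P : PositionDesign V (2 * H)} {w₁ w₁' w₂ w₂' w₃ w₃' : ℕ} {a b c : V}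
    {pa pb pc : Fin 4 × ℕ} (hb : P.InWindow w₁ w₁' b pb) (hc : P.InWindow w₂ w₂' c pc)
    (ha : P.InWindow w₃ w₃' a pa) (h₁₂ : w₁' ≤ w₂) (h₂ : w₂ ≤ w₂') (h₂₃ : w₂' ≤ w₃) (h₃ : w₃ ≤ w₃')
    (hH : 3 * w₃' ≤ H) (hca : pc.1 ≠ pa.1) (hba : pb.1 ≠ pa.1) :
    (∃ ℓ, H < ℓ ∧ P.Occ b pa.1 ℓ) ∨
      ∃ i, (i = pb.1 ∨ ∃ ℓ, H < ℓ ∧ P.Occ b i ℓ) ∧ (i = pc.1 ∨ ∃ ℓ, H < ℓ ∧ P.Occ c i ℓ) := by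
  obtain ⟨i, L, hL, h⟩ := P.cover a b c
  obtain ⟨ra, ℓa, hla, hoa⟩ := h a (.inl rfl)
  obtain ⟨rb, ℓb, hlb, hob⟩ := h b (.inr (.inl rfl))
  obtain ⟨rc, ℓc, hlc, hoc⟩ := h c (.inr (.inr rfl))
  obtain ⟨a1, a2, a3⟩ := ha.cases hoa
  obtain ⟨b1, b2, b3⟩ := hb.cases hob
  obtain ⟨c1, c2, c3⟩ := hc.cases hoc
  by_cases hrbc : rb = rc
  · subst hrbc
    exact .inr ⟨_, b2, c2⟩
  by_cases hrac : ra = rc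
  · subst hrac
    have h1 := Fin.add_le_sum_three_of_ne L hrbc
    exact absurd ((c3 (by omega)).symm.trans (a3 (by omega))) hca
  by_cases hrab : ra = rb
  · subst hrab
    have h1 := Fin.add_le_sum_three_of_ne L hrac
    have h2 := a3 (by omega)
    rw [h2] at b2
    exact .inl (b2.resolve_left hba.symm)
  · have h1 := Fin.sum_three_of_ne L hrab hrac hrbc
    omega

open Classical in
theorem card_add_lt [Fintype V] {m e : ℕ} (hm : 0 < m) (hem : 4 * e ≤ m)
    (P : PositionDesign V (2 * (3 * (100 ^ 5 * m)))) :
    Fintype.card V + e < 4 * (3 * (100 ^ 5 * m)) := by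
  by_contra! he
  set w : ℕ → ℕ := fun k => 100 ^ k * m with hw
  have hwpos : ∀ k, 0 < w k := fun k => by positivity
  have hwsucc : ∀ k, w (k + 1) = 100 * w k := fun k => by simp only [hw]; ring
  have hwmono : Monotone w := monotone_nat_of_le_succ fun k => by rw [hwsucc]; omega
  have hw0 : w 0 = m := by simp [hw]
  change PositionDesign V (2 * (3 * w 5)) at P
  change 4 * (3 * w 5) ≤ _ at he
  clear_value w
  obtain ⟨H, hH⟩ : ∃ H, H = 3 * w 5 := ⟨_, rfl⟩
  rw [← hH] at P he
  have hshallow : 4 * H ≤ #{x : V | P.IsShallow x} + 2 * e := by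
    have h1 := P.card_not_isShallow_le he
    have h2 := card_filter_add_card_filter_not (s := (univ : Finset V)) (fun x => P.IsShallow x)
    rw [card_univ] at h2
    omega
  -- The default is harmless: `InWindow` requires a sole shallow occurrence.
  let pos : V → Fin 4 × ℕ := fun x => if h : ∃ p, P.IsSoleShallow x p then h.choose else (0, 0)
  have hpos : ∀ x p, P.IsSoleShallow x p → pos x = p := by
    intro x p hp
    have h : ∃ p, P.IsSoleShallow x p := ⟨p, hp⟩
    have h1 : pos x = h.choose := dif_pos h
    rw [h1]
    exact hp.2.2 _ _ h.choose_spec.2.1 h.choose_spec.1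
  let D : V → Finset (Fin 4) := fun x => {i | ∃ ℓ, H < ℓ ∧ P.Occ x i ℓ}
  have hD : ∀ x i, i ∈ D x ↔ ∃ ℓ, H < ℓ ∧ P.Occ x i ℓ := by simp [D]
  let A : ℕ → Finset V := fun k => {x | P.InWindow (w k) (w (k + 1)) x (pos x)}
  have hA : ∀ k x, x ∈ A k ↔ P.InWindow (w k) (w (k + 1)) x (pos x) := by simp [A]
  refine window_types_contradiction A (fun x => (pos x).1) D w hwpos ?_ ?_ ?_
  -- Of the 99 `w k` positions, at most 4e ≤ `w k` are lost to non-sole occurrences and 4 `w k` to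
  -- elements with levels in (H, H + `w k`].
  · intro k hk j
    have h1 := P.card_positions_le_card_isSoleShallow hshallow
      ({j} ×ˢ Ioc (H - w (k + 1)) (H - w k)) (product_subset_product (subset_univ _)
        fun ℓ hℓ => by simp only [mem_Ioc] at hℓ ⊢; omega)
    rw [card_product, card_singleton, one_mul, Nat.card_Ioc] at h1
    have h2 := P.card_le_card_positions {x : V | ∃ i, ∃ ℓ ∈ Ioc H (H + w k), P.Occ x i ℓ}
      (univ ×ˢ Ioc H (H + w k)) (by
        intro x hx
        simp only [mem_filter, mem_univ, true_and] at hx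
        obtain ⟨i, ℓ, hℓ, ho⟩ := hx
        exact ⟨(i, ℓ), mem_product.2 ⟨mem_univ _, hℓ⟩, ho⟩)
    rw [card_product, card_univ, Fintype.card_fin, Nat.card_Ioc] at h2
    have h3 : ({x : V | ∃ p ∈ ({j} ×ˢ Ioc (H - w (k + 1)) (H - w k) : Finset (Fin 4 × ℕ)),
          P.IsSoleShallow x p} : Finset V) ⊆
        {a ∈ A k | (pos a).1 = j} ∪
          ({x : V | ∃ i, ∃ ℓ ∈ Ioc H (H + w k), P.Occ x i ℓ} : Finset V) := by
      intro x hx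
      simp only [mem_filter, mem_univ, true_and, mem_product, mem_singleton, mem_Ioc] at hx
      obtain ⟨p, ⟨hp1, hp2, hp3⟩, hp⟩ := hx
      by_cases hx : ∃ i, ∃ ℓ ∈ Ioc H (H + w k), P.Occ x i ℓ
      · exact mem_union_right _ (by simpa using hx)
      · refine mem_union_left _ (mem_filter.2 ⟨?_, by rw [hpos x p hp, hp1]⟩)
        rw [hA, hpos x p hp]
        have := P.one_le _ _ _ hp.1
        refine ⟨hp, by omega, by omega, fun i ℓ ho hℓ => ?_⟩
        by_contra hcon
        exact hx ⟨i, ℓ, mem_Ioc.2 ⟨hℓ, by omega⟩, ho⟩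
    have h4 := (card_le_card h3).trans (card_union_le _ _)
    have h5 := hwsucc k
    have h6 := hwmono (Nat.zero_le k)
    have h7 : w (k + 1) ≤ w 5 := hwmono (by omega)
    omega
  · intro k hk i
    have h1 := P.card_le_card_levels {a ∈ A k | i ∈ D a} i (Ioc H (H + w (k + 1))) (by
      intro x hx
      rw [mem_filter, hA, hD] at hx
      obtain ⟨hx, ℓ, hℓ, ho⟩ := hx
      have h2 := hx.1.add_le ho hℓ
      have h3 := hx.2.1
      exact ⟨ℓ, mem_Ioc.2 ⟨hℓ, by omega⟩, ho⟩)
    rw [Nat.card_Ioc] at h1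
    have h2 := hwsucc k
    omega
  · intro k k' k'' hk hk' hk'' b hb c hc a ha _ hba hca
    simp only [mem_insert, hD]
    rw [hA] at hb hc ha
    have h5 : w (k'' + 1) ≤ w 5 := hwmono (by omega)
    exact hb.share hc ha (hwmono hk) (hwmono (Nat.le_succ _)) (hwmono hk') (hwmono (Nat.le_succ _))
      (by omega) hca hba

end PositionDesign

/-! ### The bound on the quality -/

/-- The witness is the design of four sequences of length one. -/
theorem qualities_four_nonempty : (qualities 4).Nonempty := by
  have hocc : ∀ x i ℓ, OccursAt (fun i : Fin 4 => [i]) x i ℓ → (i, ℓ) = (x, 1) := by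
    rintro x i ℓ ⟨h1, h2⟩
    obtain ⟨h3, h4⟩ := List.getElem?_eq_some_iff.1 h2
    simp only [List.length_singleton] at h3
    rw [List.getElem_singleton] at h4
    exact Prod.ext h4 (by simp only; omega)
  refine ⟨_, 4, 3, fun i => [i], ⟨by norm_num, le_rfl, ?_, ?_⟩, rfl⟩
  · intro a b c _ _ _
    exact ⟨a, b, c, 1, 1, 1, by simp, le_rfl⟩
  · rintro x ⟨p, hp, q, hq, hne⟩
    exact absurd ((hocc x p.1 p.2 hp).trans (hocc x q.1 q.2 hq).symm) hne

theorem quality_four_le {K α : ℕ} {s : Fin 4 → List (Fin K)}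
    (hs : IsPrefixCoveringDesign 4 K α s) :
    (K : ℝ) / (α : ℝ) ≤ 2 - 1 / ((24 * 100 ^ 5 : ℕ) : ℝ) := by
  -- For α = 0 the quotient is 0 by convention.
  rcases Nat.eq_zero_or_pos α with rfl | hα
  · norm_num
  obtain ⟨P⟩ := exists_positionDesign hs
  -- The factor is chosen so that m = 4α and e = α meet 4e ≤ m; the deficit α out of 2αt becomes ε =
  -- 1/t.
  have hαt : α * (24 * 100 ^ 5) = 2 * (3 * (100 ^ 5 * (4 * α))) := by ring
  have P' := P.blowUp (24 * 100 ^ 5)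
  rw [hαt] at P'
  have h := PositionDesign.card_add_lt (m := 4 * α) (e := α) (by omega) le_rfl P'
  rw [Fintype.card_prod, Fintype.card_fin, Fintype.card_fin] at h
  have h' : K * (24 * 100 ^ 5) + α ≤ 2 * α * (24 * 100 ^ 5) := by linarith
  have h1 : (0 : ℝ) < ((24 * 100 ^ 5 : ℕ) : ℝ) := by positivity
  have hR : (K : ℝ) * ((24 * 100 ^ 5 : ℕ) : ℝ) + α ≤ 2 * α * ((24 * 100 ^ 5 : ℕ) : ℝ) := by
    exact_mod_cast h'
  have hα' : (0 : ℝ) < α := by exact_mod_cast hα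
  generalize ((24 * 100 ^ 5 : ℕ) : ℝ) = t at h1 hR
  rw [div_le_iff₀ hα']
  refine le_of_mul_le_mul_right ?_ h1
  field_simp
  linarith

theorem theorem4 :
    (qualities 4).Nonempty ∧ BddAbove (qualities 4) ∧ gammaPCD 4 < 2 := by
  have hle : ∀ q ∈ qualities 4, q ≤ 2 - 1 / ((24 * 100 ^ 5 : ℕ) : ℝ) := by
    rintro q ⟨K, α, s, hs, rfl⟩
    exact quality_four_le hs
  refine ⟨qualities_four_nonempty, ⟨_, hle⟩,
    (csSup_le qualities_four_nonempty hle).trans_lt ?_⟩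
  norm_num
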